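/- Let $X$, $Y$, $\partial X$ be complex Banach spaces with $Y$ continuously embedded in $X$. Let $A:D(A)\to X$ be a linear operator with domain $D(A)\subset Y$, and let $L:D(A)\to\partial X$ be linear and surjective. Assume that $A_0:=A|_{\ker L}$ is closed, densely defined in $X$ and has nonempty resolvent set, and that the operator $u\mapsto (Au,Lu)$ from $D(A)\subset X$ to $X\times\partial X$ is closed. Denote by $[D(A_0)]$ the space $D(A_0)=\ker L$ with the graph norm of $A_0$, and by $[D(A)_L]$ the space $D(A)$ with the graph norm of $u\mapsto (Au,Lu)$. Let $B:[D(A)_L]\to\partial X$ and $\tilde B:\partial X\to\partial X$ be bounded linear operators, and define on $X\times\partial X$ the operator $$\mathcal A\begin{pmatrix}u\\x\end{pmatrix}:=\begin{pmatrix}Au\\ Bu+\tilde Bx\end{pmatrix},\qquad D(\mathcal A):=\left\{\begin{pmatrix}u\\x\end{pmatrix}\in D(A)\times\partial X: Lu=x\right\}.$$ Suppose that $\mathcal A$ generates a cosine operator function: there is a strongly continuous map $C:\mathbb R\to\mathcal L(X\times\partial X)$ with $C(0)=I$ and $C(t+s)+C(t-s)=2C(t)C(s)$ for all $t,s\in\mathbb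 R$, such that $D(\mathcal A)$ is the set of all $\mathfrak u$ for which $\lim_{t\to0}\frac{2}{t^2}(C(t)\mathfrak u-\mathfrak u)$ exists, and $\mathcal A\mathfrak u$ is this limit. Let $S(t,\mathcal A)\mathfrak u:=\int_0^tC(s)\mathfrak u\,ds$ be the associated sine operator function. Then $S(t,\mathcal A)$ is a compact operator on $X\times\partial X$ for every $t\in\mathbb R$ if and only if the embedding $[D(A_0)]\hookrightarrow X$ is compact and $\partial X$ is finite dimensional. -/

import Mathlib

open Filter Topology

noncomputable section

namespace DynBC

section Operators

variable {E F : Type*} [NormedAddCommGroup E] [NormedSpace ℂ E]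
  [NormedAddCommGroup F] [NormedSpace ℂ F]

/-- The space `[D(T)]`: the domain of an unbounded operator `T` from `E` to `F`, to be equipped
with the graph norm `‖x‖ + ‖T x‖`. -/
def GraphDomain (T : E →ₗ.[ℂ] F) : Type _ := T.domain

namespace GraphDomain

variable (T : E →ₗ.[ℂ] F)

instance : AddCommGroup (GraphDomain T) := inferInstanceAs (AddCommGroup T.domain)

instance : Module ℂ (GraphDomain T) := inferInstanceAs (Module ℂ T.domain)

/-- The identity from `D(T)` to `[D(T)]`. -/
def ofDomain : T.domain ≃ₗ[ℂ] GraphDomain T := LinearEquiv.refl ℂ T.domain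

/-- The graph map `x ↦ (x, T x)` into the `ℓ¹`-product; it induces the graph norm. -/
def graphMap : GraphDomain T →ₗ[ℂ] WithLp 1 (E × F) :=
  (WithLp.linearEquiv 1 ℂ (E × F)).symm.toLinearMap ∘ₗ
    (T.domain.subtype.prod T.toFun) ∘ₗ (ofDomain T).symm.toLinearMap

theorem graphMap_injective : Function.Injective (graphMap T) := by
  intro x y h
  have h' : (((ofDomain T).symm x : T.domain) : E) = ((ofDomain T).symm y : T.domain) :=
    congrArg (fun p : WithLp 1 (E × F) => p.fst) h
  exact (ofDomain T).symm.injective (Subtype.ext h')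

instance : NormedAddCommGroup (GraphDomain T) :=
  NormedAddCommGroup.induced _ _ (graphMap T) (graphMap_injective T)

instance : NormedSpace ℂ (GraphDomain T) := NormedSpace.induced ℂ _ _ (graphMap T)

theorem norm_ofDomain (x : T.domain) : ‖ofDomain T x‖ = ‖(x : E)‖ + ‖T x‖ := by
  change ‖WithLp.toLp 1 ((x : E), T x)‖ = _
  have h := WithLp.prod_norm_eq_of_nat (p := 1) 1 (by norm_num) (WithLp.toLp 1 ((x : E), T x))
  simpa using h

/-- The embedding of `[D(T)]` into the ambient space. -/
def embedding : GraphDomain T →L[ℂ] E :=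
  (T.domain.subtype ∘ₗ (ofDomain T).symm.toLinearMap).mkContinuous 1 fun x => by
    have h := norm_ofDomain T ((ofDomain T).symm x)
    rw [LinearEquiv.apply_symm_apply] at h
    rw [one_mul, h]
    exact le_add_of_nonneg_right (norm_nonneg _)

end GraphDomain

/-- The resolvent set of an unbounded operator `T` on `E`: all `z` such that `z - T` maps `D(T)`
bijectively onto `E` with bounded inverse. -/
def resolventSet (T : E →ₗ.[ℂ] E) : Set ℂ :=
  {z | ∃ R : E →L[ℂ] E,
    (∀ y : E, ∃ h : R y ∈ T.domain, z • R y - T ⟨R y, h⟩ = y) ∧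
    ∀ x : T.domain, R (z • (x : E) - T x) = x}

/-- Cosine operator functions on `E`. -/
structure IsCosineFunction (C : ℝ → E →L[ℂ] E) : Prop where
  strongly_continuous : ∀ x : E, Continuous fun t => C t x
  map_zero : C 0 = ContinuousLinearMap.id ℂ E
  dAlembert : ∀ t s : ℝ, C (t + s) + C (t - s) = (2 : ℂ) • (C t).comp (C s)

/-- `K` is the generator of `C`: its domain consists of all `x` for which
`lim_{t → 0} (2 / t ^ 2) (C(t) x - x)` exists, and `K x` is that limit. -/
structure IsCosineGenerator (K : E →ₗ.[ℂ] E) (C : ℝ → E →L[ℂ] E) : Prop where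
  mem_domain_iff : ∀ x : E, x ∈ K.domain ↔
    ∃ y : E, Tendsto (fun t : ℝ => (2 / t ^ 2) • (C t x - x)) (𝓝[≠] 0) (𝓝 y)
  tendsto : ∀ x : K.domain,
    Tendsto (fun t : ℝ => (2 / t ^ 2) • (C t (x : E) - (x : E))) (𝓝[≠] 0) (𝓝 (K x))

/-- The sine operator function `S(t) x = ∫₀ᵗ C(s) x ds` associated with `C`. -/
def sine (C : ℝ → E →L[ℂ] E) (t : ℝ) (x : E) : E := ∫ s in (0 : ℝ)..t, C s x

end Operators

section Matrices

variable {X dX : Type*} [NormedAddCommGroup X] [NormedSpace ℂ X]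
  [NormedAddCommGroup dX] [NormedSpace ℂ dX]

/-- The restriction `A₀` of `A` to `ker L`. -/
def kerRestrict (A : X →ₗ.[ℂ] X) (L : A.domain →ₗ[ℂ] dX) : X →ₗ.[ℂ] X :=
  A.domRestrict ((LinearMap.ker L).map A.domain.subtype)

/-- The operator `u ↦ (A u, L u)` from `D(A)` to `X × ∂X`; its graph-norm domain is `[D(A)_L]`. -/
def column (A : X →ₗ.[ℂ] X) (L : A.domain →ₗ[ℂ] dX) : X →ₗ.[ℂ] X × dX :=
  ⟨A.domain, A.toFun.prod L⟩

/-- The subspace `{(u, x) ∈ D(A) × ∂X : L u = x}` of `X × ∂X`. -/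
def coupledDomain (A : X →ₗ.[ℂ] X) (L : A.domain →ₗ[ℂ] dX) : Submodule ℂ (X × dX) :=
  (LinearPMap.mk A.domain L).graph

theorem mem_coupledDomain (A : X →ₗ.[ℂ] X) (L : A.domain →ₗ[ℂ] dX) (p : X × dX) :
    p ∈ coupledDomain A L ↔ ∃ h : p.1 ∈ A.domain, L ⟨p.1, h⟩ = p.2 := by
  constructor
  · intro hp
    obtain ⟨u, hu, hx⟩ := (LinearPMap.mem_graph_iff _).1 hp
    obtain ⟨p1, p2⟩ := p
    subst hu
    exact ⟨u.2, hx⟩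
  · rintro ⟨h, hx⟩
    exact (LinearPMap.mem_graph_iff _).2 ⟨⟨p.1, h⟩, rfl, hx⟩

/-- The first coordinate, as a map from the coupled domain to `D(A)`. -/
def coupledFst (A : X →ₗ.[ℂ] X) (L : A.domain →ₗ[ℂ] dX) : coupledDomain A L →ₗ[ℂ] A.domain :=
  LinearMap.codRestrict A.domain (LinearMap.fst ℂ X dX ∘ₗ (coupledDomain A L).subtype)
    fun p => ((mem_coupledDomain A L p).1 p.2).1

/-- The operator matrix `(u, x) ↦ (A u, B u + Bt x)` on `X × ∂X` with domain
`{(u, x) ∈ D(A) × ∂X : L u = x}`. -/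
def operatorMatrix (A : X →ₗ.[ℂ] X) (L : A.domain →ₗ[ℂ] dX)
    (B : GraphDomain (column A L) →L[ℂ] dX) (Bt : dX →L[ℂ] dX) :
    X × dX →ₗ.[ℂ] X × dX where
  domain := coupledDomain A L
  toFun :=
    (A.toFun ∘ₗ coupledFst A L).prod
      (B.toLinearMap ∘ₗ (GraphDomain.ofDomain (column A L)).toLinearMap ∘ₗ coupledFst A L +
        Bt.toLinearMap ∘ₗ LinearMap.snd ℂ X dX ∘ₗ (coupledDomain A L).subtype)

end Matrices

end DynBC

end

/-! Both sides are equivalent to compactness of the embedding of `[D(𝒜)]` into `X × ∂X`.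

For any cosine function with generator `K`, put `T(t) = ∫₀ᵗ S(s) ds`. Then `T(t)` maps into `D(K)`
with `K T(t) = C(t) - 1`, and `C(t)x - x = T(t)Kx` on `D(K)`. If every `S(t)` is compact, so are
`T(t)` and `∫₀¹ T`, as integrals of norm continuous families, and integrating the second identity
gives `x = S(1)x - (∫₀¹ T) Kx`: the embedding is compact. Conversely, `T(t)` factors boundedly
through `[D(K)]`, hence is compact, and `S(t)` is the operator norm derivative of `T`.

For the matrix, `u ↦ (u, Lu)` identifies `[D(A)_L]` with `[D(𝒜)]`. A compact embedding makes
`[D(A₀)] → X` compact and `L` a compact surjection from a Banach space, so `∂X` is finite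
dimensional. Conversely, if `∂X` is finite dimensional, `L` has a bounded right inverse `Λ`, and `u
= (u - ΛLu) + ΛLu` splits the embedding into a part through `[D(A₀)]` and one through `∂X`. -/

noncomputable section

namespace DynBC

/-! ### Compact operators: integrals and surjections -/

section CompactIntegral

variable {E F : Type*} [NormedAddCommGroup E] [NormedSpace ℂ E]
  [NormedAddCommGroup F] [NormedSpace ℂ F] [CompleteSpace F]

theorem isCompactOperator_intervalIntegral {f : ℝ → E →L[ℂ] F} (hf : Continuous f)
    (h : ∀ t, IsCompactOperator (f t)) (a b : ℝ) :
    IsCompactOperator (∫ t in a..b, f t : E →L[ℂ] F) := by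
  let V : Submodule ℂ (E →L[ℂ] F) := compactOperator (RingHom.id ℂ) E F
  have hV : IsClosed (V : Set (E →L[ℂ] F)) := isClosed_setOfPred_isCompactOperator
  have : CompleteSpace V := hV.completeSpace_coe
  let g : ℝ → V := fun t => ⟨f t, h t⟩
  have hg : Continuous g := hf.subtype_mk _
  -- The integral can be taken inside the closed, hence complete, subspace of compact operators.
  have e := ContinuousLinearMap.intervalIntegral_comp_comm (𝕜 := ℂ) (E := V) (F := E →L[ℂ] F)
    V.subtypeL (hg.intervalIntegrable (μ := MeasureTheory.volume) a b)
  have e' : (∫ t in a..b, f t) = V.subtypeL (∫ t in a..b, g t) := e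
  rw [e']
  exact (∫ t in a..b, g t).2

/-- By the open mapping theorem a compact set is a neighbourhood of `0` in `F`; Riesz's theorem
applies. -/
theorem finiteDimensional_of_isCompactOperator_of_surjective [CompleteSpace E]
    (f : E →L[ℂ] F) (hf : IsCompactOperator f) (hs : Function.Surjective f) :
    FiniteDimensional ℂ F := by
  obtain ⟨K, hK, hpre⟩ := hf
  have h1 : f '' (f ⁻¹' K) ∈ 𝓝 (f 0) := (f.isOpenMap hs).image_mem_nhds hpre
  rw [map_zero] at h1
  have h2 : K ∈ 𝓝 (0 : F) := mem_of_superset h1 (Set.image_preimage_subset _ _)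
  obtain ⟨r, hr, hsub⟩ := Metric.nhds_basis_closedBall.mem_iff.1 h2
  exact FiniteDimensional.of_isCompact_closedBall₀ ℂ hr
    (hK.of_isClosed_subset Metric.isClosed_closedBall hsub)

end CompactIntegral

/-! ### Cosine functions, their sine functions and generators -/

section Cosine

variable {E : Type*} [NormedAddCommGroup E] [NormedSpace ℂ E] {C : ℝ → E →L[ℂ] E}

namespace IsCosineFunction

theorem apply_add_apply (hC : IsCosineFunction C) (t s : ℝ) (x : E) :
    C (t + s) x + C (t - s) x = (2 : ℂ) • C t (C s x) := by
  simpa using congrArg (fun T : E →L[ℂ] E => T x) (hC.dAlembert t s)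

theorem neg_apply (hC : IsCosineFunction C) (s : ℝ) (x : E) : C (-s) x = C s x := by
  have h := hC.apply_add_apply 0 s x
  rw [hC.map_zero, zero_add, zero_sub, ContinuousLinearMap.id_apply, two_smul] at h
  exact add_left_cancel h

theorem apply_comm (hC : IsCosineFunction C) (t s : ℝ) (x : E) :
    C t (C s x) = C s (C t x) := by
  have h1 := hC.apply_add_apply t s x
  have h2 := hC.apply_add_apply s t x
  rw [add_comm s t, ← neg_sub t s, hC.neg_apply, h1] at h2
  exact smul_right_injective E (two_ne_zero : (2 : ℂ) ≠ 0) h2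

theorem intervalIntegrable (hC : IsCosineFunction C) (x : E) (a b : ℝ) :
    IntervalIntegrable (fun s => C s x) MeasureTheory.volume a b :=
  (hC.strongly_continuous x).intervalIntegrable a b

variable [CompleteSpace E]

theorem exists_norm_le (hC : IsCosineFunction C) (T : ℝ) :
    ∃ M : ℝ, 0 ≤ M ∧ ∀ s : ℝ, |s| ≤ T → ‖C s‖ ≤ M := by
  have h : ∃ M, ∀ i : Set.Icc (-T) T, ‖C i‖ ≤ M := by
    refine banach_steinhaus fun x => ?_
    obtain ⟨M, hM⟩ := (isCompact_Icc (a := -T) (b := T)).exists_bound_of_continuousOn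
      (hC.strongly_continuous x).continuousOn
    exact ⟨M, fun i => hM i i.2⟩
  obtain ⟨M, hM⟩ := h
  exact ⟨max M 0, le_max_right _ _, fun s hs => (hM ⟨s, abs_le.1 hs⟩).trans (le_max_left _ _)⟩

/-- The sine operator function as a family of bounded operators. -/
def sineCLM (hC : IsCosineFunction C) (t : ℝ) : E →L[ℂ] E :=
  LinearMap.mkContinuousOfExistsBound
    { toFun := sine C t
      map_add' := fun x y => by
        simp only [sine, map_add]
        exact intervalIntegral.integral_add (hC.intervalIntegrable x _ _)
          (hC.intervalIntegrable y _ _)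
      map_smul' := fun c x => by
        simp only [sine, map_smul, RingHom.id_apply]
        exact intervalIntegral.integral_smul c _ }
    (by
      obtain ⟨M, -, hM⟩ := hC.exists_norm_le |t|
      refine ⟨M * |t|, fun x => ?_⟩
      have h := intervalIntegral.norm_integral_le_of_norm_le_const (a := 0) (b := t)
        (f := fun s => C s x) (C := M * ‖x‖) fun s hs => by
          refine (C s).le_of_opNorm_le (hM s ?_) x
          rcases Set.mem_uIoc.1 hs with h | h
          · rw [abs_of_pos h.1]; exact h.2.trans (le_abs_self t)
          · rw [abs_of_nonpos h.2]; exact (neg_le_neg h.1.le).trans (neg_le_abs t)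
      rw [sub_zero, mul_right_comm] at h
      exact h)

theorem sineCLM_apply (hC : IsCosineFunction C) (t : ℝ) (x : E) :
    hC.sineCLM t x = ∫ s in (0 : ℝ)..t, C s x := rfl

theorem hasDerivAt_sineCLM_apply (hC : IsCosineFunction C) (x : E) (t : ℝ) :
    HasDerivAt (fun s => hC.sineCLM s x) (C t x) t :=
  (hC.strongly_continuous x).integral_hasStrictDerivAt 0 t |>.hasDerivAt

/-- Although `C` is only strongly continuous, it is locally bounded in norm, so `S` is locally
Lipschitz in norm. -/
theorem continuous_sineCLM (hC : IsCosineFunction C) : Continuous hC.sineCLM := by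
  refine continuous_iff_continuousAt.2 fun t₀ => ?_
  obtain ⟨M, hM0, hM⟩ := hC.exists_norm_le (|t₀| + 1)
  have hball : ∀ s ∈ Metric.ball t₀ 1, |s| ≤ |t₀| + 1 := fun s hs => by
    have h1 : |s - t₀| < 1 := hs
    have h2 := abs_sub_abs_le_abs_sub s t₀
    linarith
  have hlip : LipschitzOnWith ⟨M, hM0⟩ hC.sineCLM (Metric.ball t₀ 1) := by
    refine LipschitzOnWith.of_dist_le_mul fun t ht s hs => ?_
    rw [dist_eq_norm, Real.dist_eq]
    refine ContinuousLinearMap.opNorm_le_bound _ (by positivity) fun x => ?_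
    rw [sub_apply, sineCLM_apply, sineCLM_apply,
      intervalIntegral.integral_interval_sub_left (hC.intervalIntegrable x _ _)
        (hC.intervalIntegrable x _ _)]
    refine (intervalIntegral.norm_integral_le_of_norm_le_const (C := M * ‖x‖)
      fun r hr => (C r).le_of_opNorm_le (hM r (hball r ?_)) x).trans_eq (mul_right_comm _ _ _)
    exact (convex_ball t₀ 1).ordConnected.uIcc_subset hs ht (Set.uIoc_subset_uIcc hr)
  exact hlip.continuousOn.continuousAt (Metric.ball_mem_nhds t₀ one_pos)

theorem apply_sineCLM (hC : IsCosineFunction C) (h t : ℝ) (x : E) :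
    C h (hC.sineCLM t x) = hC.sineCLM t (C h x) := by
  rw [sineCLM_apply, sineCLM_apply,
    ← (C h).intervalIntegral_comp_comm (hC.intervalIntegrable x _ _)]
  simp only [hC.apply_comm h]

theorem sineCLM_neg_apply (hC : IsCosineFunction C) (t : ℝ) (x : E) :
    hC.sineCLM (-t) x = -hC.sineCLM t x := by
  have h := intervalIntegral.integral_comp_neg (a := 0) (b := t) fun s => C s x
  simp only [hC.neg_apply, neg_zero] at h
  rw [sineCLM_apply, sineCLM_apply, h, intervalIntegral.integral_symm]

/-- The antiderivative `∫₀ᵗ S(s) ds` of the sine operator function, in the operator norm. -/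
def sineIntegral (hC : IsCosineFunction C) (t : ℝ) : E →L[ℂ] E :=
  ∫ s in (0 : ℝ)..t, hC.sineCLM s

theorem hasDerivAt_sineIntegral (hC : IsCosineFunction C) (t : ℝ) :
    HasDerivAt hC.sineIntegral (hC.sineCLM t) t :=
  (hC.continuous_sineCLM.integral_hasStrictDerivAt 0 t).hasDerivAt

theorem continuous_sineIntegral (hC : IsCosineFunction C) : Continuous hC.sineIntegral :=
  continuous_iff_continuousAt.2 fun t => (hC.hasDerivAt_sineIntegral t).continuousAt

theorem sineIntegral_apply (hC : IsCosineFunction C) (t : ℝ) (x : E) :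
    hC.sineIntegral t x = ∫ s in (0 : ℝ)..t, hC.sineCLM s x :=
  ContinuousLinearMap.intervalIntegral_apply (hC.continuous_sineCLM.intervalIntegrable _ _) x

theorem hasDerivAt_sineIntegral_apply (hC : IsCosineFunction C) (x : E) (t : ℝ) :
    HasDerivAt (fun s => hC.sineIntegral s x) (hC.sineCLM t x) t := by
  simp only [sineIntegral_apply]
  exact ((hC.continuous_sineCLM.clm_apply continuous_const).integral_hasStrictDerivAt 0 t).hasDerivAt

theorem sineIntegral_neg_apply (hC : IsCosineFunction C) (t : ℝ) (x : E) :
    hC.sineIntegral (-t) x = hC.sineIntegral t x := by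
  have h := intervalIntegral.integral_comp_neg (a := 0) (b := t) fun s => hC.sineCLM s x
  simp only [hC.sineCLM_neg_apply, neg_zero, intervalIntegral.integral_neg] at h
  rw [sineIntegral_apply, sineIntegral_apply, intervalIntegral.integral_symm, ← h, neg_neg]

theorem sineCLM_zero_apply (hC : IsCosineFunction C) (x : E) : hC.sineCLM 0 x = 0 := by
  rw [sineCLM_apply, intervalIntegral.integral_same]

theorem sineIntegral_zero_apply (hC : IsCosineFunction C) (x : E) : hC.sineIntegral 0 x = 0 := by
  rw [sineIntegral_apply, intervalIntegral.integral_same]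

theorem apply_sineIntegral (hC : IsCosineFunction C) (h t : ℝ) (x : E) :
    C h (hC.sineIntegral t x) = hC.sineIntegral t (C h x) := by
  rw [sineIntegral_apply, sineIntegral_apply,
    ← (C h).intervalIntegral_comp_comm
      ((hC.continuous_sineCLM.clm_apply continuous_const).intervalIntegrable _ _)]
  simp only [hC.apply_sineCLM h]

/-- The `t`-derivative of the difference vanishes by d'Alembert's equation, and at `t = 0` the
difference is `0` because `S` is odd. -/
theorem sineCLM_add_add_sineCLM_sub (hC : IsCosineFunction C) (h t : ℝ) (x : E) :
    hC.sineCLM (t + h) x + hC.sineCLM (t - h) x = (2 : ℂ) • C h (hC.sineCLM t x) := by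
  have hd : ∀ r, HasDerivAt (fun t => hC.sineCLM (t + h) x + hC.sineCLM (t - h) x -
      (2 : ℂ) • C h (hC.sineCLM t x)) 0 r := fun r => by
    have h1 := (hC.hasDerivAt_sineCLM_apply x (r + h)).comp_add_const r h
    have h2 := (hC.hasDerivAt_sineCLM_apply x (r - h)).comp_sub_const r h
    have h3 := (((C h).restrictScalars ℝ).hasFDerivAt.comp_hasDerivAt r
      (hC.hasDerivAt_sineCLM_apply x r)).const_smul (2 : ℂ)
    have h4 := (h1.add h2).sub h3
    have e := hC.apply_add_apply r h x
    rw [hC.apply_comm] at e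
    rw [e] at h4
    exact h4.congr_deriv (sub_self _)
  have hc := is_const_of_deriv_eq_zero (fun r => (hd r).differentiableAt) (fun r => (hd r).deriv) t 0
  simp only [zero_add, zero_sub, hC.sineCLM_neg_apply, hC.sineCLM_zero_apply, _root_.map_zero, smul_zero,
    sub_zero, add_neg_cancel] at hc
  exact sub_eq_zero.1 hc

/-- One more integration in `t`; since `T` is even, the constant is now `2 T(h) x`. -/
theorem sineIntegral_add_add_sineIntegral_sub (hC : IsCosineFunction C) (h t : ℝ) (x : E) :
    hC.sineIntegral (t + h) x + hC.sineIntegral (t - h) x =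
      (2 : ℂ) • (C h (hC.sineIntegral t x) + hC.sineIntegral h x) := by
  have hd : ∀ r, HasDerivAt (fun t => hC.sineIntegral (t + h) x + hC.sineIntegral (t - h) x -
      (2 : ℂ) • C h (hC.sineIntegral t x)) 0 r := fun r => by
    have h1 := (hC.hasDerivAt_sineIntegral_apply x (r + h)).comp_add_const r h
    have h2 := (hC.hasDerivAt_sineIntegral_apply x (r - h)).comp_sub_const r h
    have h3 := (((C h).restrictScalars ℝ).hasFDerivAt.comp_hasDerivAt r
      (hC.hasDerivAt_sineIntegral_apply x r)).const_smul (2 : ℂ)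
    have h4 := (h1.add h2).sub h3
    rw [hC.sineCLM_add_add_sineCLM_sub h r x] at h4
    exact h4.congr_deriv (sub_self _)
  have hc := is_const_of_deriv_eq_zero (fun r => (hd r).differentiableAt) (fun r => (hd r).deriv) t 0
  simp only [zero_add, zero_sub, hC.sineIntegral_neg_apply, hC.sineIntegral_zero_apply, _root_.map_zero,
    smul_zero, sub_zero] at hc
  rw [smul_add, two_smul ℂ (hC.sineIntegral h x), ← hc]
  abel

/-- The left side of the previous identity is symmetric in `h` and `t`. This exchange moves the
difference quotient at `h → 0` from `T(t)x` onto `T(h)x`, whose limit is known. -/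
theorem apply_sineIntegral_sub (hC : IsCosineFunction C) (h t : ℝ) (x : E) :
    C h (hC.sineIntegral t x) - hC.sineIntegral t x =
      C t (hC.sineIntegral h x) - hC.sineIntegral h x := by
  have h1 := hC.sineIntegral_add_add_sineIntegral_sub h t x
  have h2 := hC.sineIntegral_add_add_sineIntegral_sub t h x
  rw [add_comm h t, ← neg_sub t h, hC.sineIntegral_neg_apply, h1] at h2
  have h3 := smul_right_injective E (two_ne_zero : (2 : ℂ) ≠ 0) h2
  rw [sub_eq_sub_iff_add_eq_add]
  exact h3

/-- Integrating `C(r)x - x = o(1)` twice gives `T(r)x - (r²/2)x = o(r²)`. -/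
theorem tendsto_sineIntegral (hC : IsCosineFunction C) (x : E) :
    Tendsto (fun h : ℝ => (2 / h ^ 2) • hC.sineIntegral h x) (𝓝[≠] 0) (𝓝 x) := by
  have hd : ∀ r, HasDerivAt (fun h : ℝ => hC.sineIntegral h x - (h ^ 2 / 2) • x)
      (hC.sineCLM r x - r • x) r := fun r => by
    have h1 : HasDerivAt (fun h : ℝ => h ^ 2 / 2) r r := by
      simpa using ((hasDerivAt_id r).pow 2).div_const 2
    exact (hC.hasDerivAt_sineIntegral_apply x r).sub (h1.smul_const x)
  have hd2 : ∀ r, HasDerivAt (fun h : ℝ => hC.sineCLM h x - h • x) (C r x - x) r := fun r => by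
    have h1 := ((hasDerivAt_id r).smul_const x).congr_deriv (one_smul ℝ x)
    exact (hC.hasDerivAt_sineCLM_apply x r).sub h1
  rw [Metric.tendsto_nhdsWithin_nhds]
  intro ε hε
  have hcont : Continuous fun r => C r x := hC.strongly_continuous x
  -- The mean value bounds lose the factor `1/2` of `r²/2`; after multiplication by `2/r²` the bound
  -- is `ε/2 < ε`.
  obtain ⟨δ, hδ, hδ'⟩ := Metric.continuousAt_iff.1 hcont.continuousAt (ε / 4) (by positivity)
  have hb0 : ∀ r : ℝ, |r| < δ → ‖C r x - x‖ ≤ ε / 4 := fun r hr => by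
    have : dist (C r x) (C 0 x) < ε / 4 := hδ' (by simpa using hr)
    rw [hC.map_zero, dist_eq_norm] at this
    exact this.le
  have hb1 : ∀ r : ℝ, |r| < δ → ‖hC.sineCLM r x - r • x‖ ≤ ε / 4 * |r| := fun r hr => by
    have := (convex_ball (0 : ℝ) δ).norm_image_sub_le_of_norm_hasDerivWithin_le
      (fun s _ => (hd2 s).hasDerivWithinAt) (fun s hs => hb0 s (by simpa using hs))
      (Metric.mem_ball_self hδ) (show r ∈ Metric.ball (0 : ℝ) δ by simpa using hr)
    simpa [hC.sineCLM_zero_apply] using this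
  have hb2 : ∀ r : ℝ, |r| < δ → ‖hC.sineIntegral r x - (r ^ 2 / 2) • x‖ ≤ ε / 4 * |r| * |r| :=
    fun r hr => by
    have := (convex_closedBall (0 : ℝ) |r|).norm_image_sub_le_of_norm_hasDerivWithin_le
      (C := ε / 4 * |r|)
      (fun s _ => (hd s).hasDerivWithinAt) (fun s hs => by
        have hs' : |s| ≤ |r| := by simpa using hs
        exact (hb1 s (hs'.trans_lt hr)).trans (by gcongr))
      (Metric.mem_closedBall_self (abs_nonneg r))
      (show r ∈ Metric.closedBall (0 : ℝ) |r| by simp)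
    simpa [hC.sineIntegral_zero_apply] using this
  refine ⟨δ, hδ, fun {r} hr0 hr => ?_⟩
  have hr0' : r ≠ 0 := hr0
  have hr' : |r| < δ := by simpa using hr
  have e : (2 / r ^ 2) • hC.sineIntegral r x - x =
      (2 / r ^ 2) • (hC.sineIntegral r x - (r ^ 2 / 2) • x) := by
    rw [smul_sub, smul_smul, show 2 / r ^ 2 * (r ^ 2 / 2) = 1 by field_simp, one_smul]
  rw [dist_eq_norm, e, norm_smul]
  have hn : ‖2 / r ^ 2‖ = 2 / r ^ 2 := by rw [Real.norm_eq_abs, abs_of_pos (by positivity)]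
  rw [hn]
  calc 2 / r ^ 2 * ‖hC.sineIntegral r x - (r ^ 2 / 2) • x‖
      ≤ 2 / r ^ 2 * (ε / 4 * |r| * |r|) := by gcongr; exact hb2 r hr'
    _ = ε / 2 := by
        rw [mul_assoc (ε / 4), abs_mul_abs_self]; field_simp; norm_num
    _ < ε := by linarith

end IsCosineFunction

namespace IsCosineGenerator

variable [CompleteSpace E] {K : E →ₗ.[ℂ] E}

theorem exists_apply_sineIntegral (hK : IsCosineGenerator K C) (hC : IsCosineFunction C)
    (t : ℝ) (x : E) :
    ∃ h : hC.sineIntegral t x ∈ K.domain, K ⟨hC.sineIntegral t x, h⟩ = C t x - x := by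
  have hlim : Tendsto (fun h : ℝ => (2 / h ^ 2) •
      (C h (hC.sineIntegral t x) - hC.sineIntegral t x)) (𝓝[≠] 0) (𝓝 (C t x - x)) := by
    have h1 := hC.tendsto_sineIntegral x
    have h2 := (((C t).continuous.tendsto x).comp h1).sub h1
    refine h2.congr fun h => ?_
    rw [hC.apply_sineIntegral_sub h t x, smul_sub, Function.comp_apply]
    exact congrArg (· - _) (((C t).restrictScalars ℝ).map_smul _ _)
  have hmem := (hK.mem_domain_iff _).2 ⟨_, hlim⟩
  exact ⟨hmem, tendsto_nhds_unique (hK.tendsto ⟨_, hmem⟩) hlim⟩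

/-- Both sides are limits of `(2/h²)(C(h) - 1)T(t)x`: exchange `h` and `t` for one, commute `C(h)`
with `T(t)` for the other. -/
theorem apply_sub_eq_sineIntegral (hK : IsCosineGenerator K C) (hC : IsCosineFunction C)
    (t : ℝ) (x : K.domain) : C t (x : E) - x = hC.sineIntegral t (K x) := by
  have h1 := hC.tendsto_sineIntegral (x : E)
  have h2 := (((C t).continuous.tendsto (x : E)).comp h1).sub h1
  have h3 := ((hC.sineIntegral t).continuous.tendsto _).comp (hK.tendsto x)
  refine tendsto_nhds_unique h2 (h3.congr fun h => ?_)
  have e1 : hC.sineIntegral t ((2 / h ^ 2) • (C h (x : E) - x)) =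
      (2 / h ^ 2) • hC.sineIntegral t (C h (x : E) - x) :=
    ((hC.sineIntegral t).restrictScalars ℝ).map_smul _ _
  have e2 : C t ((2 / h ^ 2) • hC.sineIntegral h (x : E)) =
      (2 / h ^ 2) • C t (hC.sineIntegral h (x : E)) :=
    ((C t).restrictScalars ℝ).map_smul _ _
  simp only [Function.comp_apply]
  rw [e1, e2, ← smul_sub, map_sub, ← hC.apply_sineIntegral, hC.apply_sineIntegral_sub h t]

end IsCosineGenerator

end Cosine

/-! ### Graph norm spaces -/

namespace GraphDomain

variable {E F G : Type*} [NormedAddCommGroup E] [NormedSpace ℂ E]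
  [NormedAddCommGroup F] [NormedSpace ℂ F] [NormedAddCommGroup G] [NormedSpace ℂ G]
  (T : E →ₗ.[ℂ] F)

theorem norm_eq (x : GraphDomain T) :
    ‖x‖ = ‖(((ofDomain T).symm x : T.domain) : E)‖ + ‖T ((ofDomain T).symm x)‖ :=
  norm_ofDomain T ((ofDomain T).symm x)

/-- The operator `T` as a bounded operator on `[D(T)]`. -/
def operator : GraphDomain T →L[ℂ] F :=
  (T.toFun ∘ₗ (ofDomain T).symm.toLinearMap).mkContinuous 1 fun x => by
    rw [one_mul, norm_eq]
    exact le_add_of_nonneg_left (norm_nonneg _)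

variable {T}

/-- A linear map into `D(T)` is bounded into `[D(T)]` as soon as it and its composition with `T`
are bounded. -/
def lift (f : G →ₗ[ℂ] T.domain) (a : G →L[ℂ] E) (b : G →L[ℂ] F)
    (ha : ∀ x, (f x : E) = a x) (hb : ∀ x, T (f x) = b x) : G →L[ℂ] GraphDomain T :=
  ((ofDomain T).toLinearMap ∘ₗ f).mkContinuous (‖a‖ + ‖b‖) fun x => by
    change ‖ofDomain T (f x)‖ ≤ _
    rw [norm_ofDomain, ha, hb, add_mul]
    exact add_le_add (a.le_opNorm x) (b.le_opNorm x)

/-- The graph map is an isometry onto the closed graph. -/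
theorem completeSpace [CompleteSpace E] [CompleteSpace F] (hT : T.IsClosed) :
    CompleteSpace (GraphDomain T) := by
  have hiso : Isometry (graphMap T) :=
    AddMonoidHomClass.isometry_of_norm (graphMap T) fun _ => rfl
  have hr : Set.range (graphMap T) = WithLp.ofLp ⁻¹' (T.graph : Set (E × F)) := by
    ext p
    constructor
    · rintro ⟨x, rfl⟩
      exact T.mem_graph ((ofDomain T).symm x)
    · intro hp
      obtain ⟨x, hx1, hx2⟩ := (LinearPMap.mem_graph_iff _).1 hp
      refine ⟨ofDomain T x, WithLp.ofLp_injective 1 (Prod.ext hx1 hx2)⟩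
  have hcl : IsClosed (Set.range (graphMap T)) := by
    rw [hr]
    exact IsClosed.preimage (WithLp.prod_continuous_ofLp 1 E F) hT
  exact (completeSpace_iff_isComplete_range hiso.isUniformInducing).2 hcl.isComplete

end GraphDomain

/-! ### Compact sine function versus compact embedding of the generator's domain -/

section Cosine

variable {E : Type*} [NormedAddCommGroup E] [NormedSpace ℂ E] [CompleteSpace E]
  {C : ℝ → E →L[ℂ] E} {K : E →ₗ.[ℂ] E}

theorem IsCosineGenerator.isCompactOperator_embedding (hK : IsCosineGenerator K C)
    (hC : IsCosineFunction C) (h : ∀ t, IsCompactOperator (sine C t)) :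
    IsCompactOperator (GraphDomain.embedding K) := by
  have hT : ∀ t, IsCompactOperator (hC.sineIntegral t) := fun t =>
    isCompactOperator_intervalIntegral hC.continuous_sineCLM h 0 t
  have hU := isCompactOperator_intervalIntegral hC.continuous_sineIntegral hT 0 1
  have hS : IsCompactOperator (hC.sineCLM 1) := h 1
  have hcomp := (hS.comp_clm (GraphDomain.embedding K)).sub
    (hU.comp_clm (GraphDomain.operator K))
  suffices hx : ∀ x, GraphDomain.embedding K x = hC.sineCLM 1 (GraphDomain.embedding K x) -
      (∫ t in (0 : ℝ)..1, hC.sineIntegral t) (GraphDomain.operator K x) from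
    (funext hx : ⇑(GraphDomain.embedding K) = _) ▸ hcomp
  intro x
  have e : ∀ s, C s (GraphDomain.embedding K x) =
      GraphDomain.embedding K x + hC.sineIntegral s (GraphDomain.operator K x) := fun s =>
    eq_add_of_sub_eq' (hK.apply_sub_eq_sineIntegral hC s ((GraphDomain.ofDomain K).symm x))
  have hint := (hC.continuous_sineIntegral.clm_apply
    (continuous_const (y := GraphDomain.operator K x))).intervalIntegrable
      (μ := MeasureTheory.volume) 0 1
  rw [hC.sineCLM_apply, ContinuousLinearMap.intervalIntegral_apply
    (hC.continuous_sineIntegral.intervalIntegrable _ _)]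
  simp only [e]
  rw [intervalIntegral.integral_add (by simp) hint]
  simp

theorem IsCosineGenerator.isCompactOperator_sine (hK : IsCosineGenerator K C)
    (hC : IsCosineFunction C) (h : IsCompactOperator (GraphDomain.embedding K)) (t : ℝ) :
    IsCompactOperator (sine C t) := by
  have hT : ∀ t, IsCompactOperator (hC.sineIntegral t) := fun t => by
    let f : E →ₗ[ℂ] K.domain := LinearMap.codRestrict K.domain (hC.sineIntegral t).toLinearMap
      fun x => (hK.exists_apply_sineIntegral hC t x).1
    exact h.comp_clm (GraphDomain.lift f (hC.sineIntegral t) (C t - ContinuousLinearMap.id ℂ E)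
      (fun _ => rfl) fun x => (hK.exists_apply_sineIntegral hC t x).2)
  have hcl : IsClosed (compactOperator (RingHom.id ℂ) E E : Set (E →L[ℂ] E)) :=
    isClosed_setOfPred_isCompactOperator
  have hlim := (hasDerivAt_iff_tendsto_slope.1 (hC.hasDerivAt_sineIntegral t))
  refine hcl.mem_of_tendsto hlim (Eventually.of_forall fun s => ?_)
  have hsub : hC.sineIntegral s - hC.sineIntegral t ∈ compactOperator (RingHom.id ℂ) E E :=
    sub_mem (hT s) (hT t)
  -- The slope carries a real scalar, while the compact operators form a complex submodule.
  have e : slope hC.sineIntegral t s =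
      (((s - t)⁻¹ : ℝ) : ℂ) • (hC.sineIntegral s - hC.sineIntegral t) := by
    rw [slope_def_module, Complex.coe_smul]
  rw [e]
  exact Submodule.smul_mem _ _ hsub

end Cosine

/-! ### The operator matrix and its boundary decomposition -/

section Matrices

open GraphDomain

variable {X dX : Type*} [NormedAddCommGroup X] [NormedSpace ℂ X]
  [NormedAddCommGroup dX] [NormedSpace ℂ dX]
  (A : X →ₗ.[ℂ] X) (L : A.domain →ₗ[ℂ] dX)
  (B : GraphDomain (column A L) →L[ℂ] dX) (Bt : dX →L[ℂ] dX)

/-- The operator `L`, bounded on `[D(A)_L]`. -/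
def boundaryCLM : GraphDomain (column A L) →L[ℂ] dX :=
  ContinuousLinearMap.snd ℂ X dX ∘L operator (column A L)

theorem boundaryCLM_apply (u : GraphDomain (column A L)) :
    boundaryCLM A L u = L ((ofDomain (column A L)).symm u) := rfl

theorem mem_kerRestrict_domain (u : A.domain) :
    (u : X) ∈ (kerRestrict A L).domain ↔ L u = 0 := by
  constructor
  · rintro ⟨⟨v, hv, hvu⟩, -⟩
    have : v = u := Subtype.ext hvu
    exact this ▸ hv
  · intro h
    exact ⟨⟨u, h, rfl⟩, u.2⟩

/-- The inclusion of `D(A₀)` into `D(A)`. -/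
def kerInclusion : (kerRestrict A L).domain →ₗ[ℂ] A.domain :=
  Submodule.inclusion inf_le_right

theorem apply_kerInclusion (u : (kerRestrict A L).domain) : L (kerInclusion A L u) = 0 :=
  (mem_kerRestrict_domain A L (kerInclusion A L u)).1 u.2

/-- The embedding `[D(A₀)] → [D(A)_L]`. -/
def kerToColumn : GraphDomain (kerRestrict A L) →L[ℂ] GraphDomain (column A L) :=
  lift (kerInclusion A L ∘ₗ (ofDomain (kerRestrict A L)).symm.toLinearMap)
    (embedding (kerRestrict A L)) ((operator (kerRestrict A L)).prod 0) (fun _ => rfl)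
    fun u => Prod.ext rfl (apply_kerInclusion A L ((ofDomain (kerRestrict A L)).symm u))

/-- The map `u ↦ (u, L u)` from `[D(A)_L]` to the domain of the operator matrix. -/
def columnToMatrix : GraphDomain (column A L) →L[ℂ] GraphDomain (operatorMatrix A L B Bt) :=
  lift
    (LinearMap.codRestrict (coupledDomain A L)
      ((embedding (column A L)).prod (boundaryCLM A L)).toLinearMap fun u =>
        (mem_coupledDomain A L _).2 ⟨((ofDomain (column A L)).symm u).2, rfl⟩)
    ((embedding (column A L)).prod (boundaryCLM A L))
    ((ContinuousLinearMap.fst ℂ X dX ∘L operator (column A L)).prod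
      (B + Bt ∘L boundaryCLM A L))
    (fun _ => rfl) fun _ => rfl

/-- The map `(u, L u) ↦ u` from the domain of the operator matrix to `[D(A)_L]`. -/
def matrixToColumn : GraphDomain (operatorMatrix A L B Bt) →L[ℂ] GraphDomain (column A L) :=
  lift (coupledFst A L ∘ₗ (ofDomain (operatorMatrix A L B Bt)).symm.toLinearMap)
    (ContinuousLinearMap.fst ℂ X dX ∘L embedding (operatorMatrix A L B Bt))
    ((ContinuousLinearMap.fst ℂ X dX ∘L operator (operatorMatrix A L B Bt)).prod
      (ContinuousLinearMap.snd ℂ X dX ∘L embedding (operatorMatrix A L B Bt)))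
    (fun _ => rfl)
    fun p => Prod.ext rfl
      ((mem_coupledDomain A L _).1 ((ofDomain (operatorMatrix A L B Bt)).symm p).2).2

theorem embedding_operatorMatrix (p : GraphDomain (operatorMatrix A L B Bt)) :
    embedding (operatorMatrix A L B Bt) p =
      (embedding (column A L) (matrixToColumn A L B Bt p),
        boundaryCLM A L (matrixToColumn A L B Bt p)) :=
  Prod.ext rfl
    ((mem_coupledDomain A L _).1 ((ofDomain (operatorMatrix A L B Bt)).symm p).2).2.symm

variable {A L}

/-- The projection `u ↦ u - Λ L u` of `[D(A)_L]` onto `[D(A₀)]` for a bounded right inverse `Λ`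
of `L`. -/
def columnToKer (Λ : dX →L[ℂ] GraphDomain (column A L)) (hΛ : ∀ x, boundaryCLM A L (Λ x) = x) :
    GraphDomain (column A L) →L[ℂ] GraphDomain (kerRestrict A L) :=
  let P : GraphDomain (column A L) →L[ℂ] GraphDomain (column A L) :=
    ContinuousLinearMap.id ℂ _ - Λ ∘L boundaryCLM A L
  lift
    (LinearMap.codRestrict (kerRestrict A L).domain
      (embedding (column A L) ∘L P).toLinearMap fun u =>
        (mem_kerRestrict_domain A L ((ofDomain (column A L)).symm (P u))).2 (by
          rw [← boundaryCLM_apply]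
          change boundaryCLM A L (u - Λ (boundaryCLM A L u)) = 0
          rw [map_sub, hΛ, sub_self]))
    (embedding (column A L) ∘L P)
    (ContinuousLinearMap.fst ℂ X dX ∘L operator (column A L) ∘L P)
    (fun _ => rfl) fun _ => rfl

theorem embedding_columnToKer (Λ : dX →L[ℂ] GraphDomain (column A L))
    (hΛ : ∀ x, boundaryCLM A L (Λ x) = x) (u : GraphDomain (column A L)) :
    embedding (kerRestrict A L) (columnToKer Λ hΛ u) =
      embedding (column A L) u - embedding (column A L) (Λ (boundaryCLM A L u)) :=
  map_sub (embedding (column A L)) u (Λ (boundaryCLM A L u))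

theorem isCompactOperator_embedding_kerRestrict
    (h : IsCompactOperator (embedding (operatorMatrix A L B Bt))) :
    IsCompactOperator (embedding (kerRestrict A L)) :=
  (h.comp_clm (columnToMatrix A L B Bt ∘L kerToColumn A L)).clm_comp
    (ContinuousLinearMap.fst ℂ X dX)

theorem isCompactOperator_boundaryCLM
    (h : IsCompactOperator (embedding (operatorMatrix A L B Bt))) :
    IsCompactOperator (boundaryCLM A L) :=
  (h.comp_clm (columnToMatrix A L B Bt)).clm_comp (ContinuousLinearMap.snd ℂ X dX)

theorem isCompactOperator_embedding_operatorMatrix [FiniteDimensional ℂ dX]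
    (hL : Function.Surjective L) (h : IsCompactOperator (embedding (kerRestrict A L))) :
    IsCompactOperator (embedding (operatorMatrix A L B Bt)) := by
  obtain ⟨R, hR⟩ := L.exists_rightInverse_of_surjective (LinearMap.range_eq_top.2 hL)
  -- An algebraic right inverse of `L` is automatically bounded on the finite dimensional `∂X`.
  let Λ : dX →L[ℂ] GraphDomain (column A L) :=
    LinearMap.toContinuousLinearMap ((ofDomain (column A L)).toLinearMap ∘ₗ R)
  have hΛ : ∀ x, boundaryCLM A L (Λ x) = x := fun x => LinearMap.congr_fun hR x
  have hid : IsCompactOperator (ContinuousLinearMap.id ℂ dX) := by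
    have : ProperSpace dX := FiniteDimensional.proper ℂ dX
    exact ⟨Metric.closedBall 0 1, isCompact_closedBall 0 1,
      Metric.closedBall_mem_nhds 0 one_pos⟩
  have h1 := (h.comp_clm (columnToKer Λ hΛ ∘L matrixToColumn A L B Bt)).clm_comp
    (ContinuousLinearMap.inl ℂ X dX)
  have h2 := (hid.comp_clm (boundaryCLM A L ∘L matrixToColumn A L B Bt)).clm_comp
    ((embedding (column A L) ∘L Λ).prod (ContinuousLinearMap.id ℂ dX))
  suffices hp : ∀ p, embedding (operatorMatrix A L B Bt) p =
      (embedding (kerRestrict A L) (columnToKer Λ hΛ (matrixToColumn A L B Bt p)), 0) +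
        (embedding (column A L) (Λ (boundaryCLM A L (matrixToColumn A L B Bt p))),
          boundaryCLM A L (matrixToColumn A L B Bt p)) from
    (funext hp : ⇑(embedding (operatorMatrix A L B Bt)) = _) ▸ h1.add h2
  intro p
  rw [embedding_operatorMatrix]
  refine Prod.ext ?_ ?_
  · change _ = embedding (kerRestrict A L) (columnToKer Λ hΛ (matrixToColumn A L B Bt p)) + _
    rw [embedding_columnToKer]
    exact (sub_add_cancel _ _).symm
  · exact (zero_add _).symm

end Matrices

end DynBC

end

theorem corollary6p4
    {X Y dX : Type*}
    [NormedAddCommGroup X] [NormedSpace ℂ X] [CompleteSpace X]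
    [NormedAddCommGroup Y] [NormedSpace ℂ Y] [CompleteSpace Y]
    [NormedAddCommGroup dX] [NormedSpace ℂ dX] [CompleteSpace dX]
    (J : Y →L[ℂ] X) (hJ : Function.Injective J)
    (A : X →ₗ.[ℂ] X) (hAY : (A.domain : Set X) ⊆ Set.range J)
    (L : A.domain →ₗ[ℂ] dX) (hL : Function.Surjective L)
    (hA₀closed : (DynBC.kerRestrict A L).IsClosed)
    (hA₀dense : Dense ((DynBC.kerRestrict A L).domain : Set X))
    (hA₀res : (DynBC.resolventSet (DynBC.kerRestrict A L)).Nonempty)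
    (hAL : (DynBC.column A L).IsClosed)
    (B : DynBC.GraphDomain (DynBC.column A L) →L[ℂ] dX)
    (Bt : dX →L[ℂ] dX)
    (C : ℝ → (X × dX) →L[ℂ] (X × dX))
    (hC : DynBC.IsCosineFunction C)
    (hgen : DynBC.IsCosineGenerator (DynBC.operatorMatrix A L B Bt) C) :
    (∀ t : ℝ, IsCompactOperator (DynBC.sine C t)) ↔
      (IsCompactOperator (DynBC.GraphDomain.embedding (DynBC.kerRestrict A L)) ∧
        FiniteDimensional ℂ dX) := by
  constructor
  · intro h
    have hemb := hgen.isCompactOperator_embedding hC h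
    -- Needed for the open mapping theorem applied to `L` on `[D(A)_L]`.
    have : CompleteSpace (DynBC.GraphDomain (DynBC.column A L)) :=
      DynBC.GraphDomain.completeSpace hAL
    refine ⟨DynBC.isCompactOperator_embedding_kerRestrict B Bt hemb,
      DynBC.finiteDimensional_of_isCompactOperator_of_surjective (DynBC.boundaryCLM A L)
        (DynBC.isCompactOperator_boundaryCLM B Bt hemb) fun x => ?_⟩
    obtain ⟨u, hu⟩ := hL x
    exact ⟨DynBC.GraphDomain.ofDomain _ u, hu⟩
  · rintro ⟨h, hfin⟩
    exact hgen.isCompactOperator_sine hC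
      (DynBC.isCompactOperator_embedding_operatorMatrix B Bt hL h)
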